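/- Let $L\ge 1$ and $d_0,d_1,\dots,d_{L-1}\ge 1$ be integers and let $\sigma:\mathbb R\to\mathbb R$ be measurable. On a probability space let $w^{(\ell)}_{i,j}$ and $b^{(\ell)}_i$ ($0\le\ell\le L$, $i,j\in\mathbb N=\{1,2,\dots\}$) be real random variables such that (a) all the variables $w^{(\ell)}_{i,j}$, $b^{(\ell)}_i$ are mutually independent; (b) for every $\ell<L$ and every $i$, the weights $w^{(\ell)}_{i,1},w^{(\ell)}_{i,2},\dots$ leaving neuron $i$ are identically distributed, and for every $j$ the last-layer weights $w^{(L)}_{1,j},w^{(L)}_{2,j},\dots$ entering output $j$ are identically distributed (for instance, all weights of a layer have the same law); (c) for every $\ell\le L$, the biases $b^{(\ell)}_1,b^{(\ell)}_2,\dots$ are identically distributed; (d) $\mathbb E[w^{(L)}_{i,j}]=0$ (in particular $w^{(L)}_{i,j}$ is integrable) for all $i,j$. Fix $t\in\mathbb R^{d_0}$ and an output index $j\ge1$, and define the network by $$X^{(0)}_i=\sigma\Big(\tfrac1{\sqrt{d_0}}\sum_{k=1}^{d_0}t_k w^{(0)}_{k,i}+b^{(0)}_i\Big),\qquad X^{(\ell)}_i=\sigma\Big(\tfrac1{\sqrt{d_\ell}}\sum_{k=1}^{d_\ell}X^{(\ell-1)}_k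 w^{(\ell)}_{k,i}+b^{(\ell)}_i\Big)\quad(1\le\ell\le L-1),$$ $$Y_i=X^{(L-1)}_i\,w^{(L)}_{i,j},\qquad S_j^{(d_0,\dots,d_L)}(t)=\frac1{\sqrt{d_L}}\sum_{i=1}^{d_L}Y_i .$$ A centered Gaussian mixture is a probability measure on $\mathbb R$ of the form $A\mapsto\int_{[0,\infty)}N(0,v)(A)\,d\rho(v)$, where $\rho$ is a probability measure on $[0,\infty)$ and $N(0,0)=\delta_0$. 1. If $\mathbb E[Y_1^2]<\infty$, then, with $d_0,\dots,d_{L-1}$ held fixed, $S_j^{(d_0,\dots,d_L)}(t)$ converges weakly, as $d_L\to\infty$, to a random variable whose law is a centered Gaussian mixture. 2. If all weights and biases have finite moments of every order and $|\sigma|\le|u|$ for some real polynomial $u$, then $\mathbb E[Y_1^2]<\infty$, and hence the convergence in 1 holds. -/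

import Mathlib

open MeasureTheory ProbabilityTheory Filter
open scoped NNReal ENNReal

noncomputable section

/-- The infinite-width pre-activations of a fully connected random network in the NTK
parametrization, before the bias is added. Neurons of each layer are numbered `0, 1, 2, …`;
`w ℓ i j` is the weight of layer `ℓ` from neuron `i` to neuron `j`, and `b ℓ i` is the bias added
to coordinate `i` before the activation function that feeds layer `ℓ + 1`. The input dimension is
`d₀`, the input is `t`, and for `ℓ ≥ 1` only the first `d ℓ` neurons of hidden layer `ℓ` are used.
The value at `ℓ = L` is the output `S^{(d₀, d₁, …, d_L)}(t)` of the network with `L` hidden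
layers. -/
def preActivation {Ω : Type*} (σ : ℝ → ℝ) {d₀ : ℕ} (t : Fin d₀ → ℝ) (d : ℕ → ℕ)
    (w : ℕ → ℕ → ℕ → Ω → ℝ) (b : ℕ → ℕ → Ω → ℝ) : ℕ → ℕ → Ω → ℝ
  | 0, j, ω => 1 / Real.sqrt d₀ * ∑ i : Fin d₀, t i * w 0 i j ω
  | ℓ + 1, j, ω => 1 / Real.sqrt (d (ℓ + 1)) *
      ∑ i ∈ Finset.range (d (ℓ + 1)),
        σ (preActivation σ t d w b ℓ i ω + b ℓ i ω) * w (ℓ + 1) i j ω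

/-- The activations `X_i^{(d₀, …, d_ℓ)} = σ (pr_i NN^{(d₀, …, d_ℓ)}(t) + b_i^{(ℓ)})`. -/
def activation {Ω : Type*} (σ : ℝ → ℝ) {d₀ : ℕ} (t : Fin d₀ → ℝ) (d : ℕ → ℕ)
    (w : ℕ → ℕ → ℕ → Ω → ℝ) (b : ℕ → ℕ → Ω → ℝ) (ℓ i : ℕ) (ω : Ω) : ℝ :=
  σ (preActivation σ t d w b ℓ i ω + b ℓ i ω)

/-- The summands `Y_i = X_i^{(d₀, …, d_{L-1})} w_{i,j}^{(L)}` of the output `j` of the network with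
`L ≥ 1` hidden layers. They depend on `d 1, …, d (L - 1)` only, not on `d L`. -/
def lastLayerTerm {Ω : Type*} (σ : ℝ → ℝ) {d₀ : ℕ} (t : Fin d₀ → ℝ) (d : ℕ → ℕ)
    (w : ℕ → ℕ → ℕ → Ω → ℝ) (b : ℕ → ℕ → Ω → ℝ) (L j i : ℕ) (ω : Ω) : ℝ :=
  activation σ t d w b (L - 1) i ω * w L i j ω

/-- The output `S_j^{(d₀, d₁, …, d_{L-1}, n)}(t)` of the network with `L ≥ 1` hidden layers, whose
last hidden layer has width `n`; the other widths are those given by `d`. -/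
def networkOutput {Ω : Type*} (σ : ℝ → ℝ) {d₀ : ℕ} (t : Fin d₀ → ℝ) (d : ℕ → ℕ)
    (w : ℕ → ℕ → ℕ → Ω → ℝ) (b : ℕ → ℕ → Ω → ℝ) (L n j : ℕ) (ω : Ω) : ℝ :=
  preActivation σ t (Function.update d L n) w b L j ω

/-- A centered Gaussian mixture: the mixture `∫ N(0, v) dρ(v)` of centered normal laws, where the
variance `v` is drawn from a probability measure `ρ` on `[0, ∞)`. As in Mathlib, `N(0, 0)` is the
Dirac mass at `0`. -/
def IsCenteredGaussianMixture (ν : Measure ℝ) : Prop :=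
  ∃ ρ : Measure ℝ≥0, IsProbabilityMeasure ρ ∧
    ∀ A : Set ℝ, MeasurableSet A → ν A = ∫⁻ v, gaussianReal 0 v A ∂ρ

/-- The real random variables `S n` converge weakly, as `n → ∞`, to a random variable whose law is
a centered Gaussian mixture. -/
def ConvergesToCenteredGaussianMixture {Ω : Type*} [MeasurableSpace Ω] (P : Measure Ω)
    [IsProbabilityMeasure P] (S : ℕ → Ω → ℝ) : Prop :=
  ∃ ν : ProbabilityMeasure ℝ, IsCenteredGaussianMixture (ν : Measure ℝ) ∧
    TendstoInDistribution S atTop (fun x : ℝ => x) (fun _ => P) (ν : Measure ℝ)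

end

/-!
Write `L = M + 1`. Let `V` be the rescaled vector that the weights of layer `M` act on, and let the
column `C i` collect all the parameters that belong to neuron `i` of the last hidden layer: its
incoming weights `w M k i`, its bias `b M i` and its outgoing weight `w L i j`. Then
`Y_i = f (V, C i)` for one fixed measurable `f`. The columns are independent and identically
distributed, and they are independent of `V`, because `V` is a function of parameters of earlier
layers only (`exists_preActivation_eq_sum`). Hence, given `V = v`, the summands are i.i.d.; they
are centred, because the outgoing weight is centred and independent of the rest of the column.

Given `V = v`, the central limit theorem yields convergence of the normalized sums to
`N(0, g v)`, where `g v = E[f (v, C 0) ^ 2]` is finite for almost every `v` by Fubini's theorem.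
Integrating out `v` with dominated convergence gives convergence to the mixture of the `N(0, v)`
whose mixing measure is the law of `g V`
(`convergesToCenteredGaussianMixture_of_conditionally_iid`).

For the second part, the real random variables that lie in `L^p` for all `p` are closed under
linear combinations, products and composition with polynomially bounded functions, so that
by induction over the layers all activations have this property (`memLp_preActivation`).
-/

open scoped Topology

/-! ### Independence of groups of variables -/

/-- Regrouping: the rows of an independent doubly indexed family are independent as random
sequences. This is the converse of `iIndepFun_uncurry'`, and it allows infinite rows. -/
theorem iIndepFun_curry {Ω ι κ 𝓧 : Type*} [MeasurableSpace Ω] [MeasurableSpace 𝓧]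
    {P : Measure Ω} {X : ι × κ → Ω → 𝓧} (mX : ∀ p, Measurable (X p)) (h : iIndepFun X P) :
    iIndepFun (fun i ω k => X (i, k) ω) P := by
  have := h.isProbabilityMeasure
  have hp : ∀ i k, IsProbabilityMeasure (P.map (X (i, k))) :=
    fun i k => Measure.isProbabilityMeasure_map (mX _).aemeasurable
  rw [iIndepFun_iff_map_fun_eq_infinitePi_map (by fun_prop)]
  have hrow : ∀ i, P.map (fun ω k => X (i, k) ω) =
      Measure.infinitePi fun k => P.map (X (i, k)) := fun i =>
    (h.precomp (Prod.mk_right_injective i)).map_fun_eq_infinitePi_map (fun _ => mX _)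
  simp_rw [hrow]
  rw [← Measure.infinitePi_map_curry (fun i k => P.map (X (i, k))),
    ← h.map_fun_eq_infinitePi_map mX, Measure.map_map (by fun_prop) (by fun_prop)]
  rfl

/-- Random variables that depend on disjoint, possibly infinite, parts of an independent family are
independent. -/
theorem indepFun_of_measurable_iSup_comap {Ω ι 𝓧 α β : Type*} [MeasurableSpace Ω]
    [m𝓧 : MeasurableSpace 𝓧] [MeasurableSpace α] [MeasurableSpace β] {P : Measure Ω}
    {X : ι → Ω → 𝓧} (mX : ∀ i, Measurable (X i)) (h : iIndepFun X P) {S T : Set ι} (hST : Disjoint S T)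
    {A : Ω → α} {B : Ω → β}
    (hA : Measurable[⨆ i ∈ S, m𝓧.comap (X i)] A) (hB : Measurable[⨆ i ∈ T, m𝓧.comap (X i)] B) :
    IndepFun A B P :=
  indep_of_indep_of_le (indep_iSup_of_disjoint (fun i => (mX i).comap_le) h hST)
    hA.comap_le hB.comap_le

theorem measurable_iSup_comap {Ω ι 𝓧 : Type*} [m𝓧 : MeasurableSpace 𝓧] (X : ι → Ω → 𝓧)
    {S : Set ι} {i : ι} (hi : i ∈ S) : Measurable[⨆ i ∈ S, m𝓧.comap (X i)] (X i) :=
  (comap_measurable (X i)).mono (le_iSup₂ (f := fun i _ => m𝓧.comap (X i)) i hi) le_rfl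

/-! ### The central limit theorem for conditionally i.i.d. variables -/

/-- The central limit theorem for centred variables, with the variance written as a second
moment; the variance may be zero. -/
theorem tendstoInDistribution_inv_sqrt_mul_sum_of_centered {Ω : Type*} [MeasurableSpace Ω]
    {P : Measure Ω} [IsProbabilityMeasure P] {X : ℕ → Ω → ℝ} (hX : MemLp (X 0) 2 P)
    (hmean : ∫ ω, X 0 ω ∂P = 0) (hindep : iIndepFun X P)
    (hident : ∀ i, IdentDistrib (X i) (X 0) P P) :
    TendstoInDistribution (fun (n : ℕ) ω => 1 / √(n : ℝ) * ∑ i ∈ Finset.range n, X i ω) atTop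
      (fun x : ℝ => x) (fun _ => P) (gaussianReal 0 (∫ ω, X 0 ω ^ 2 ∂P).toNNReal) := by
  have hv : Var[X 0; P] = ∫ ω, X 0 ω ^ 2 ∂P :=
    variance_of_integral_eq_zero hX.aestronglyMeasurable.aemeasurable hmean
  have h := tendstoInDistribution_inv_sqrt_mul_sum_sub (P := P) (X := X)
    (Y := fun x : ℝ => x) (P' := gaussianReal 0 Var[X 0; P].toNNReal)
    ⟨by fun_prop, by simp⟩ hX hindep hident
  simp only [hmean, mul_zero, sub_zero, hv] at h
  simpa only [one_div] using h

/-- If `V` is independent of the i.i.d. sequence `C`, then the variables `f (V, C i)` are i.i.d.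
given `V`. If they are conditionally centred and have a finite second moment, their normalized sums
converge to the mixture of centred normal laws whose variance is distributed as the conditional
variance of the summands. -/
theorem convergesToCenteredGaussianMixture_of_conditionally_iid {Ω E F : Type*}
    [MeasurableSpace Ω] [MeasurableSpace E] [MeasurableSpace F] {P : Measure Ω}
    [IsProbabilityMeasure P] {V : Ω → E} {C : ℕ → Ω → F} {f : E → F → ℝ}
    (hV : Measurable V) (hC : ∀ i, Measurable (C i)) (hf : Measurable (Function.uncurry f))
    (hVC : IndepFun V (fun ω i => C i ω) P) (hindep : iIndepFun C P)
    (hident : ∀ i, IdentDistrib (C i) (C 0) P P)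
    (hmean : ∀ v, ∫ ω, f v (C 0 ω) ∂P = 0)
    (hint : Integrable (fun ω => f (V ω) (C 0 ω) ^ 2) P) :
    ConvergesToCenteredGaussianMixture P
      (fun n ω => 1 / √(n : ℝ) * ∑ i ∈ Finset.range n, f (V ω) (C i ω)) := by
  have hfv : ∀ v, Measurable (f v) := fun v => hf.comp measurable_prodMk_left
  -- the conditional variance of the summands given `V = v`
  set g : E → ℝ≥0 := fun v => (∫ ω, f v (C 0 ω) ^ 2 ∂P).toNNReal with hg
  have hgm : Measurable g := by
    have : StronglyMeasurable fun v => ∫ ω, f v (C 0 ω) ^ 2 ∂P := by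
      apply StronglyMeasurable.integral_prod_right'
        (f := fun p : E × Ω => f p.1 (C 0 p.2) ^ 2)
      exact ((hf.comp (measurable_fst.prodMk ((hC 0).comp measurable_snd))).pow_const
        2).stronglyMeasurable
    exact this.measurable.real_toNNReal
  have hGm : Measurable fun v : ℝ≥0 => gaussianReal 0 v :=
    measurable_gaussianReal.comp measurable_prodMk_left
  have : IsProbabilityMeasure (P.map V) := Measure.isProbabilityMeasure_map hV.aemeasurable
  have hρ : IsProbabilityMeasure ((P.map V).map g) :=
    Measure.isProbabilityMeasure_map hgm.aemeasurable
  set ν : Measure ℝ := ((P.map V).map g).bind fun v => gaussianReal 0 v with hνdef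
  have hνA : ∀ A : Set ℝ, MeasurableSet A → ν A = ∫⁻ v, gaussianReal 0 v A ∂((P.map V).map g) :=
    fun A hA => Measure.bind_apply hA hGm.aemeasurable
  have hν : IsProbabilityMeasure ν := ⟨by rw [hνA _ MeasurableSet.univ]; simp⟩
  suffices TendstoInDistribution (fun (n : ℕ) ω =>
      1 / √(n : ℝ) * ∑ i ∈ Finset.range n, f (V ω) (C i ω)) atTop (fun x : ℝ => x)
      (fun _ => P) ν from ⟨⟨ν, hν⟩, ⟨_, hρ, hνA⟩, this⟩
  have hSm : ∀ n : ℕ, Measurable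
      fun ω => 1 / √(n : ℝ) * ∑ i ∈ Finset.range n, f (V ω) (C i ω) := fun n =>
    (Finset.measurable_sum _ fun i _ => hf.comp (hV.prodMk (hC i))).const_mul _
  refine ⟨fun n => (hSm n).aemeasurable, by fun_prop, ?_⟩
  refine ProbabilityMeasure.tendsto_iff_forall_lintegral_tendsto.2 fun h => ?_
  have hhm : Measurable fun x => (h x : ℝ≥0∞) := h.continuous.measurable.coe_nnreal_ennreal
  -- for almost every `v`, the central limit theorem applies to the summands `f v (C i)`
  have hL2 : ∀ᵐ v ∂(P.map V), Integrable (fun ω => f v (C 0 ω) ^ 2) P := by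
    have hVC0 : P.map (fun ω => (V ω, C 0 ω)) = (P.map V).prod (P.map (C 0)) :=
      (indepFun_iff_map_prod_eq_prod_map_map hV.aemeasurable (hC 0).aemeasurable).1
        (hVC.comp measurable_id (measurable_pi_apply 0))
    have hm : Measurable fun p : E × F => f p.1 p.2 ^ 2 := hf.pow_const 2
    have h1 : Integrable (fun p : E × F => f p.1 p.2 ^ 2) ((P.map V).prod (P.map (C 0))) := by
      rw [← hVC0, integrable_map_measure hm.aestronglyMeasurable
        (hV.prodMk (hC 0)).aemeasurable]
      exact hint
    filter_upwards [h1.prod_right_ae] with v hv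
    exact (integrable_map_measure ((hfv v).pow_const 2).aestronglyMeasurable
      (hC 0).aemeasurable).1 hv
  have hclt : ∀ᵐ v ∂(P.map V), Tendsto (fun n : ℕ =>
      ∫⁻ ω, h (1 / √(n : ℝ) * ∑ i ∈ Finset.range n, f v (C i ω)) ∂P) atTop
      (𝓝 (∫⁻ x, h x ∂(gaussianReal 0 (g v)))) := by
    filter_upwards [hL2] with v hv
    have hmem : MemLp (fun ω => f v (C 0 ω)) 2 P :=
      (memLp_two_iff_integrable_sq ((hfv v).comp (hC 0)).aestronglyMeasurable).2 hv
    have key := tendstoInDistribution_inv_sqrt_mul_sum_of_centered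
      (X := fun i ω => f v (C i ω)) hmem (hmean v) (hindep.comp _ fun _ => hfv v)
      fun i => (hident i).comp (hfv v)
    have := ProbabilityMeasure.tendsto_iff_forall_lintegral_tendsto.1 key.tendsto h
    simp only [ProbabilityMeasure.coe_mk, Measure.map_id'] at this
    refine this.congr fun n => ?_
    exact lintegral_map hhm
      ((Finset.measurable_sum _ fun i _ => (hfv v).comp (hC i)).const_mul _)
  -- integrate out `V`, which is independent of the sequence `C`
  have hfub : ∀ n : ℕ, ∫⁻ ω, h (1 / √(n : ℝ) * ∑ i ∈ Finset.range n, f (V ω) (C i ω)) ∂P =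
      ∫⁻ v, ∫⁻ ω, h (1 / √(n : ℝ) * ∑ i ∈ Finset.range n, f v (C i ω)) ∂P ∂(P.map V) := by
    intro n
    have hCm : Measurable fun ω i => C i ω := measurable_pi_lambda _ hC
    have hm : Measurable fun p : E × (ℕ → F) =>
        (h (1 / √(n : ℝ) * ∑ i ∈ Finset.range n, f p.1 (p.2 i)) : ℝ≥0∞) :=
      hhm.comp ((Finset.measurable_sum _ fun i _ =>
        hf.comp (measurable_fst.prodMk ((measurable_pi_apply i).comp measurable_snd))).const_mul _)
    have hlaw := (indepFun_iff_map_prod_eq_prod_map_map hV.aemeasurable hCm.aemeasurable).1 hVC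
    have e1 := lintegral_map (μ := P) hm (hV.prodMk hCm)
    rw [hlaw, lintegral_prod _ hm.aemeasurable] at e1
    rw [← e1]
    refine lintegral_congr fun v => ?_
    exact lintegral_map (hm.comp measurable_prodMk_left) hCm
  -- the mixing measure is the law of `g V`
  have hlim : ∫⁻ x, h x ∂ν = ∫⁻ v, ∫⁻ x, h x ∂(gaussianReal 0 (g v)) ∂(P.map V) := by
    rw [hνdef, Measure.lintegral_bind hGm.aemeasurable hhm.aemeasurable]
    exact lintegral_map ((Measure.measurable_lintegral hhm).comp hGm) hgm
  simp only [ProbabilityMeasure.coe_mk, Measure.map_id']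
  rw [hlim]
  simp_rw [fun n : ℕ => (lintegral_map (μ := P) hhm (hSm n)).trans (hfub n)]
  refine tendsto_lintegral_of_dominated_convergence (fun _ => (nndist h 0 : ℝ≥0∞))
    (fun n => ?_) (fun n => ae_of_all _ fun v => ?_) (by simp) hclt
  · refine Measurable.lintegral_prod_right' (f := fun p : E × Ω =>
      (h (1 / √(n : ℝ) * ∑ i ∈ Finset.range n, f p.1 (C i p.2)) : ℝ≥0∞)) ?_
    exact hhm.comp ((Finset.measurable_sum _ fun i _ =>
      hf.comp (measurable_fst.prodMk ((hC i).comp measurable_snd))).const_mul _)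
  · calc _ ≤ ∫⁻ _, (nndist h 0 : ℝ≥0∞) ∂P :=
        lintegral_mono fun ω => 
          ENNReal.coe_le_coe.2 (BoundedContinuousFunction.NNReal.upper_bound h _)
      _ = _ := by simp

/-! ### The layers of the network -/

section Network

variable {Ω : Type*} {σ : ℝ → ℝ} {d₀ : ℕ} {t : Fin d₀ → ℝ} {d : ℕ → ℕ}
  {w : ℕ → ℕ → ℕ → Ω → ℝ} {b : ℕ → ℕ → Ω → ℝ}

theorem preActivation_congr_width {d' : ℕ → ℕ} {M : ℕ} (h : ∀ ℓ ≤ M, d ℓ = d' ℓ) (i : ℕ) (ω : Ω) :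
    preActivation σ t d w b M i ω = preActivation σ t d' w b M i ω := by
  induction M generalizing i with
  | zero => rfl
  | succ M ih =>
    simp only [preActivation, h (M + 1) le_rfl, ih fun ℓ hℓ => h ℓ (hℓ.trans M.le_succ)]

theorem networkOutput_succ (M n j : ℕ) (ω : Ω) :
    networkOutput σ t d w b (M + 1) n j ω =
      1 / √(n : ℝ) * ∑ i ∈ Finset.range n, lastLayerTerm σ t d w b (M + 1) j i ω := by
  have h : ∀ ℓ ≤ M, Function.update d (M + 1) n ℓ = d ℓ := fun ℓ hℓ =>
    Function.update_of_ne (by omega) _ _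
  simp only [networkOutput, preActivation, lastLayerTerm, activation, Function.update_self,
    Nat.add_sub_cancel, preActivation_congr_width h]

/-- The measurable space on `Ω` is arbitrary: besides the ambient one, the lemma is used for the
`σ`-algebra generated by a part of the parameters. -/
theorem measurable_preActivation [MeasurableSpace Ω] (hσ : Measurable σ) {M : ℕ}
    (hw : ∀ ℓ ≤ M, ∀ i j, Measurable (w ℓ i j)) (hb : ∀ ℓ < M, ∀ i, Measurable (b ℓ i)) (i : ℕ) :
    Measurable (preActivation σ t d w b M i) := by
  induction M generalizing i with
  | zero =>
    exact (Finset.measurable_sum Finset.univ fun (k : Fin d₀) _ =>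
      (hw 0 le_rfl k i).const_mul (t k)).const_mul _
  | succ M ih =>
    refine (Finset.measurable_sum _ fun k _ => Measurable.mul (hσ.comp (Measurable.add
      (ih (fun ℓ hℓ => hw ℓ (hℓ.trans M.le_succ)) (fun ℓ hℓ => hb ℓ (by omega)) k)
      (hb M M.lt_succ_self k))) (hw _ le_rfl k i)).const_mul _

/-- The pre-activations of layer `M` are linear in the weights of layer `M`, with the same
coefficient vector `V` for all neurons, and `V` is measurable with respect to the parameters of
the layers before `M`. For `M = 0` the vector `V` is the rescaled input, extended by zero; for `M > 0` it
consists of the rescaled activations of the preceding layer. -/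
theorem exists_preActivation_eq_sum (hσ : Measurable σ) (M : ℕ) :
    ∃ (m : ℕ) (V : Ω → ℕ → ℝ),
      (∀ i ω, preActivation σ t d w b M i ω = ∑ k ∈ Finset.range m, V ω k * w M k i ω) ∧
      ∀ m₀ : MeasurableSpace Ω, (∀ ℓ < M, ∀ i j, Measurable[m₀] (w ℓ i j)) →
        (∀ ℓ < M, ∀ i, Measurable[m₀] (b ℓ i)) → Measurable[m₀] V := by
  cases M with
  | zero =>
    refine ⟨d₀, fun _ k => if h : k < d₀ then 1 / √(d₀ : ℝ) * t ⟨k, h⟩ else 0, fun i ω => ?_,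
      fun _ _ _ => measurable_const⟩
    simp [preActivation, Finset.sum_range, Finset.mul_sum, mul_assoc]
  | succ M =>
    refine ⟨d (M + 1), fun ω k => 1 / √(d (M + 1) : ℝ) *
      σ (preActivation σ t d w b M k ω + b M k ω), fun i ω => ?_, fun m₀ hw hb => ?_⟩
    · simp only [preActivation, Finset.mul_sum, mul_assoc]
    · exact measurable_pi_lambda _ fun k => (hσ.comp (Measurable.add (measurable_preActivation hσ
        (fun ℓ hℓ => hw ℓ (Nat.lt_succ_of_le hℓ)) (fun ℓ hℓ => hb ℓ (hℓ.trans M.lt_succ_self)) k)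
        (hb M M.lt_succ_self k))).const_mul _

/-- The parameters that belong to neuron `i` of the last hidden layer `M + 1` and to the output `j`:
the incoming weights `w M k i` (index `inl k`), the bias `b M i` (index `inr false`) and the
outgoing weight `w (M + 1) i j` (index `inr true`). -/
def neuronColumn (w : ℕ → ℕ → ℕ → Ω → ℝ) (b : ℕ → ℕ → Ω → ℝ) (M j i : ℕ) :
    ℕ ⊕ Bool → Ω → ℝ :=
  Sum.elim (fun k => w M k i) fun s => cond s (w (M + 1) i j) (b M i)

/-- The output of the network converges to a centred Gaussian mixture if the summands of the last
layer have a finite second moment. -/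
theorem convergesToCenteredGaussianMixture_networkOutput [MeasurableSpace Ω] {P : Measure Ω}
    [IsProbabilityMeasure P] {M : ℕ} (hσ : Measurable σ)
    (hw : ∀ ℓ ≤ M + 1, ∀ i j, Measurable (w ℓ i j)) (hb : ∀ ℓ ≤ M + 1, ∀ i, Measurable (b ℓ i))
    (hindep : iIndepFun
      (Sum.elim (fun p : Fin (M + 1 + 1) × ℕ × ℕ => w p.1 p.2.1 p.2.2)
        (fun p : Fin (M + 1 + 1) × ℕ => b p.1 p.2)) P)
    (hw_hidden : ∀ i j j', IdentDistrib (w M i j) (w M i j') P P)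
    {j : ℕ} (hw_last : ∀ i i', IdentDistrib (w (M + 1) i j) (w (M + 1) i' j) P P)
    (hb_ident : ∀ i i', IdentDistrib (b M i) (b M i') P P)
    (hw_mean : ∫ ω, w (M + 1) 0 j ω ∂P = 0)
    (hint : Integrable (fun ω => lastLayerTerm σ t d w b (M + 1) j 0 ω ^ 2) P) :
    ConvergesToCenteredGaussianMixture P (fun n => networkOutput σ t d w b (M + 1) n j) := by
  obtain ⟨m, V, hVsum, hVmeas⟩ :=
    exists_preActivation_eq_sum (t := t) (d := d) (w := w) (b := b) hσ M
  set X : (Fin (M + 1 + 1) × ℕ × ℕ) ⊕ (Fin (M + 1 + 1) × ℕ) → Ω → ℝ :=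
    Sum.elim (fun p => w p.1 p.2.1 p.2.2) (fun p => b p.1 p.2) with hX
  have mX : ∀ p, Measurable (X p)
    | .inl p => hw _ (by omega) _ _
    | .inr p => hb _ (by omega) _
  -- position `(i, k)` among the columns, as an index into the family of all parameters
  let ι : ℕ × (ℕ ⊕ Bool) → (Fin (M + 1 + 1) × ℕ × ℕ) ⊕ (Fin (M + 1 + 1) × ℕ)
    | (i, .inl k) => .inl (⟨M, by omega⟩, k, i)
    | (i, .inr false) => .inr (⟨M, by omega⟩, i)
    | (i, .inr true) => .inl (⟨M + 1, by omega⟩, i, j)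
  have hι : Function.Injective ι := by
    rintro ⟨i, k | _ | _⟩ ⟨i', k' | _ | _⟩ h <;> simp_all [ι]
  have hXι : ∀ i k, X (ι (i, k)) = neuronColumn w b M j i k := by
    rintro i (k | _ | _) <;> rfl
  have mcol : ∀ i k, Measurable (neuronColumn w b M j i k) := fun i k => hXι i k ▸ mX _
  have hcol : iIndepFun (fun p : ℕ × (ℕ ⊕ Bool) => neuronColumn w b M j p.1 p.2) P := by
    have := hindep.precomp hι
    simpa only [hXι] using this
  have hrow : ∀ i, iIndepFun (neuronColumn w b M j i) P := fun i =>
    iIndepFun.precomp (g := Prod.mk i) (Prod.mk_right_injective i) hcol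
  let C : ℕ → Ω → ℕ ⊕ Bool → ℝ := fun i ω k => neuronColumn w b M j i k ω
  let f : (ℕ → ℝ) → (ℕ ⊕ Bool → ℝ) → ℝ := fun v c =>
    σ ((∑ k ∈ Finset.range m, v k * c (.inl k)) + c (.inr false)) * c (.inr true)
  have hterm : ∀ i ω, lastLayerTerm σ t d w b (M + 1) j i ω = f (V ω) (C i ω) := fun i ω => by
    simp [lastLayerTerm, activation, hVsum, f, C, neuronColumn]
  have hf : Measurable (Function.uncurry f) := by
    have : Measurable fun p : (ℕ → ℝ) × (ℕ ⊕ Bool → ℝ) =>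
      (∑ k ∈ Finset.range m, p.1 k * p.2 (.inl k)) + p.2 (.inr false) := by fun_prop
    exact (hσ.comp this).mul (by fun_prop)
  have hC : ∀ i, Measurable (C i) := fun i => measurable_pi_lambda _ (mcol i)
  simp_rw [hterm] at hint
  have main := convergesToCenteredGaussianMixture_of_conditionally_iid (V := V) (C := C)
    (hVmeas _ (fun ℓ hℓ => hw ℓ (by omega)) fun ℓ hℓ => hb ℓ (by omega)) hC hf ?_
    (iIndepFun_curry (fun p => mcol p.1 p.2) hcol) (fun i => ?_) (fun v => ?_) hint
  · have hS : (fun n => networkOutput σ t d w b (M + 1) n j) =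
        fun (n : ℕ) ω => 1 / √(n : ℝ) * ∑ i ∈ Finset.range n, f (V ω) (C i ω) := by
      funext n ω
      simp only [networkOutput_succ, hterm]
    rwa [hS]
  · -- `V` is a function of parameters of the layers below `M`, the columns contain none of these
    refine indepFun_of_measurable_iSup_comap mX hindep (disjoint_compl_left (a := Set.range ι))
      (hVmeas _ (fun ℓ hℓ i k => ?_) fun ℓ hℓ i => ?_) ?_
    · refine measurable_iSup_comap X (i := .inl (⟨ℓ, by omega⟩, i, k)) ?_
      rintro ⟨⟨i', k' | _ | _⟩, h⟩ <;> simp [ι] at h <;> omega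
    · refine measurable_iSup_comap X (i := .inr (⟨ℓ, by omega⟩, i)) ?_
      rintro ⟨⟨i', k' | _ | _⟩, h⟩ <;> simp [ι] at h <;> omega
    · refine @measurable_pi_lambda _ _ _ (_) _ _ fun i =>
        @measurable_pi_lambda _ _ _ (_) _ _ fun k => ?_
      have := measurable_iSup_comap X (Set.mem_range_self (f := ι) (i, k))
      rwa [hXι] at this
  · refine IdentDistrib.pi (fun k => ?_) (hrow i) (hrow 0)
    rcases k with k | _ | _
    exacts [hw_hidden k i 0, hb_ident i 0, hw_last i 0]
  · -- the outgoing weight is centred and independent of the activation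
    have hi : IndepFun
        (fun ω => σ ((∑ k ∈ Finset.range m, v k * C 0 ω (.inl k)) + C 0 ω (.inr false)))
        (fun ω => C 0 ω (.inr true)) P := by
      refine indepFun_of_measurable_iSup_comap (mcol 0) (hrow 0)
        (disjoint_compl_left (a := {Sum.inr true})) (hσ.comp (Measurable.add
          (Finset.measurable_sum _ fun k _ => Measurable.const_mul ?_ _) ?_))
        (measurable_iSup_comap _ rfl)
      · exact measurable_iSup_comap (neuronColumn w b M j 0) (by simp)
      · exact measurable_iSup_comap (neuronColumn w b M j 0) (by simp)
    have hm : Measurable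
        fun ω => σ ((∑ k ∈ Finset.range m, v k * C 0 ω (.inl k)) + C 0 ω (.inr false)) := by
      have := fun k => mcol 0 k
      exact hσ.comp (by fun_prop)
    have := hi.integral_mul_eq_mul_integral hm.aestronglyMeasurable
      (mcol 0 (.inr true)).aestronglyMeasurable
    refine this.trans ?_
    rw [show ∫ ω, C 0 ω (.inr true) ∂P = 0 from hw_mean, mul_zero]

/-! ### Moments of the activations -/

theorem memLp_natCast_of_integrable_pow [MeasurableSpace Ω] {P : Measure Ω} {X : Ω → ℝ}
    (hX : AEStronglyMeasurable X P) {p : ℕ} (h : Integrable (fun ω => X ω ^ p) P) :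
    MemLp X p P := by
  rcases eq_or_ne p 0 with rfl | hp
  · simpa using hX
  · rw [← integrable_norm_rpow_iff hX (by simpa using hp) (by simp)]
    simpa using h.norm

/-- Variables with finite moments of every order are closed under products, by Hölder's inequality
with exponents `2 p, 2 p`. -/
theorem memLp_mul_of_forall_memLp [MeasurableSpace Ω] {P : Measure Ω} {X Y : Ω → ℝ}
    (hX : ∀ p : ℕ, MemLp X p P) (hY : ∀ p : ℕ, MemLp Y p P) (p : ℕ) :
    MemLp (fun ω => X ω * Y ω) p P := by
  have : ENNReal.HolderTriple ((2 * p : ℕ) : ℝ≥0∞) ((2 * p : ℕ) : ℝ≥0∞) p := by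
    constructor
    push_cast
    rw [ENNReal.mul_inv (by simp) (by simp), ← add_mul, ENNReal.inv_two_add_inv_two, one_mul]
  exact (hY (2 * p)).mul' (hX (2 * p))

theorem memLp_polynomial_eval_of_forall_memLp [MeasurableSpace Ω] {P : Measure Ω}
    [IsFiniteMeasure P] {X : Ω → ℝ} (hX : ∀ p : ℕ, MemLp X p P) (u : Polynomial ℝ) (p : ℕ) :
    MemLp (fun ω => u.eval (X ω)) p P := by
  induction u using Polynomial.induction_on generalizing p with
  | C a => simpa using memLp_const a
  | add u v hu hv =>
    simp only [Polynomial.eval_add]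
    exact (hu p).add (hv p)
  | monomial n a ih =>
    simpa [pow_succ, mul_assoc] using memLp_mul_of_forall_memLp ih hX p

theorem memLp_comp_of_forall_memLp [MeasurableSpace Ω] {P : Measure Ω} [IsFiniteMeasure P]
    {X : Ω → ℝ} (hX : ∀ p : ℕ, MemLp X p P) (hσ : Measurable σ) {u : Polynomial ℝ}
    (hu : ∀ x, |σ x| ≤ |u.eval x|) (p : ℕ) : MemLp (fun ω => σ (X ω)) p P :=
  (memLp_polynomial_eval_of_forall_memLp hX u p).mono
    (hσ.comp_aemeasurable (hX 0).aestronglyMeasurable.aemeasurable).aestronglyMeasurable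
    (ae_of_all _ fun ω => hu (X ω))

theorem memLp_preActivation [MeasurableSpace Ω] {P : Measure Ω} [IsFiniteMeasure P]
    (hσ : Measurable σ) {u : Polynomial ℝ} (hu : ∀ x, |σ x| ≤ |u.eval x|) {M : ℕ}
    (hw : ∀ ℓ ≤ M, ∀ i j, ∀ p : ℕ, MemLp (w ℓ i j) p P)
    (hb : ∀ ℓ < M, ∀ i, ∀ p : ℕ, MemLp (b ℓ i) p P) (i p : ℕ) :
    MemLp (preActivation σ t d w b M i) p P := by
  induction M generalizing i p with
  | zero =>
    exact (memLp_finsetSum Finset.univ fun (k : Fin d₀) _ =>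
      (hw 0 le_rfl k i p).const_mul (t k)).const_mul _
  | succ M ih =>
    exact (memLp_finsetSum _ fun k _ => memLp_mul_of_forall_memLp
      (memLp_comp_of_forall_memLp (fun q => (ih (fun ℓ hℓ => hw ℓ (hℓ.trans M.le_succ))
        (fun ℓ hℓ => hb ℓ (by omega)) k q).add (hb M M.lt_succ_self k q)) hσ hu)
      (hw _ le_rfl k i) p).const_mul _

theorem integrable_lastLayerTerm_sq [MeasurableSpace Ω] {P : Measure Ω} [IsFiniteMeasure P]
    (hσ : Measurable σ) {u : Polynomial ℝ} (hu : ∀ x, |σ x| ≤ |u.eval x|) {M : ℕ}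
    (hw : ∀ ℓ ≤ M + 1, ∀ i j, ∀ p : ℕ, MemLp (w ℓ i j) p P)
    (hb : ∀ ℓ ≤ M + 1, ∀ i, ∀ p : ℕ, MemLp (b ℓ i) p P) (j i : ℕ) :
    Integrable (fun ω => lastLayerTerm σ t d w b (M + 1) j i ω ^ 2) P := by
  have h : ∀ p : ℕ, MemLp (lastLayerTerm σ t d w b (M + 1) j i) p P :=
    memLp_mul_of_forall_memLp
      (memLp_comp_of_forall_memLp (fun q => (memLp_preActivation hσ hu
        (fun ℓ hℓ => hw ℓ (by omega)) (fun ℓ hℓ => hb ℓ (by omega)) i q).add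
          (hb M (by omega) i q)) hσ hu)
      (hw _ le_rfl i j)
  exact (h 2).integrable_sq

end Network

theorem theorem3p14 {Ω : Type*} [MeasurableSpace Ω] (P : Measure Ω) [IsProbabilityMeasure P]
    (L : ℕ) (hL : 1 ≤ L) (d₀ : ℕ) (hd₀ : 1 ≤ d₀) (d : ℕ → ℕ) (hd : ∀ ℓ, 1 ≤ ℓ → ℓ < L → 1 ≤ d ℓ)
    (σ : ℝ → ℝ) (hσ : Measurable σ)
    (w : ℕ → ℕ → ℕ → Ω → ℝ) (b : ℕ → ℕ → Ω → ℝ)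
    (hw : ∀ ℓ ≤ L, ∀ i j, Measurable (w ℓ i j)) (hb : ∀ ℓ ≤ L, ∀ i, Measurable (b ℓ i))
    -- all weights and biases of the layers `0, …, L` are mutually independent
    (hindep : iIndepFun
      (Sum.elim (fun p : Fin (L + 1) × ℕ × ℕ => w p.1 p.2.1 p.2.2)
        (fun p : Fin (L + 1) × ℕ => b p.1 p.2)) P)
    -- in each layer below the last one, the weights that leave a given neuron have the same law
    (hw_hidden : ∀ ℓ < L, ∀ i j j', IdentDistrib (w ℓ i j) (w ℓ i j') P P)
    -- in the last layer, the weights that enter a given output have the same law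
    (hw_last : ∀ j i i', IdentDistrib (w L i j) (w L i' j) P P)
    (hb_ident : ∀ ℓ ≤ L, ∀ i i', IdentDistrib (b ℓ i) (b ℓ i') P P)
    (hw_mean : ∀ i j, Integrable (w L i j) P ∧ ∫ ω, w L i j ω ∂P = 0)
    (t : Fin d₀ → ℝ) (j : ℕ) :
    (Integrable (fun ω => lastLayerTerm σ t d w b L j 0 ω ^ 2) P →
      ConvergesToCenteredGaussianMixture P (fun n => networkOutput σ t d w b L n j)) ∧
    ((∀ ℓ ≤ L, ∀ i j' m : ℕ, Integrable (fun ω => w ℓ i j' ω ^ m) P) →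
      (∀ ℓ ≤ L, ∀ i m : ℕ, Integrable (fun ω => b ℓ i ω ^ m) P) →
      (∃ u : Polynomial ℝ, ∀ x, |σ x| ≤ |u.eval x|) →
      Integrable (fun ω => lastLayerTerm σ t d w b L j 0 ω ^ 2) P ∧
      ConvergesToCenteredGaussianMixture P (fun n => networkOutput σ t d w b L n j)) := by
  obtain ⟨M, rfl⟩ : ∃ M, L = M + 1 := ⟨L - 1, by omega⟩
  have hconv := convergesToCenteredGaussianMixture_networkOutput (t := t) (d := d) hσ hw hb hindep
    (hw_hidden M M.lt_succ_self) (hw_last j) (hb_ident M M.le_succ) (hw_mean 0 j).2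
  refine ⟨hconv, fun hwm hbm ⟨u, hu⟩ => ?_⟩
  have hint := integrable_lastLayerTerm_sq (P := P) (t := t) (d := d) hσ hu
    (fun ℓ hℓ i k p =>
      memLp_natCast_of_integrable_pow (hw ℓ hℓ i k).aestronglyMeasurable (hwm ℓ hℓ i k p))
    (fun ℓ hℓ i p =>
      memLp_natCast_of_integrable_pow (hb ℓ hℓ i).aestronglyMeasurable (hbm ℓ hℓ i p)) j 0
  exact ⟨hint, hconv hint⟩
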